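/- A tuple generating dependency (TGD) is a rule $\Phi(\bar x,\bar y)\Rightarrow\exists\bar z\;\Psi(\bar x,\bar z)$, where the body $\Phi$ and the head $\Psi$ are non-empty finite conjunctions of relational atoms over variables (no constants, no equality), $\bar x$ lists the variables occurring both in $\Phi$ and in $\Psi$, $\bar y$ those occurring only in $\Phi$, and $\bar z$ (possibly empty) those occurring only in $\Psi$. The TGD is called multi-head because $\Psi$ may consist of several atoms. A program is a finite list of TGDs; it is over a binary signature if all its relation symbols have arity $1$ or $2$. Given a program $\mathcal T$ and a finite database instance (finite set of facts) $D$, the Semi-Oblivious Chase of $\mathcal T$ on $D$ starts from $D$ and proceeds in rounds. In each round, for every TGD of $\mathcal T$ (with number $i$) and every tuple $\bar a$ of current elements such that $\exists\bar y\;\Phi(\bar a,\bar y)$ holds in the current structure, the atoms of $\Psi(\bar a,\bar c)$ are added, where $\bar c$ is the tuple of new elements (nulls) associated with $i$ and $\bar a$: the components of $\bar c$ are the Skolem terms $h_{i,z}(\bar a)$, one for each variable $z$ in $\bar z$; thus one tuple $\bar c$ is created for each $i$ and $\bar a$, independently of the values of $\bar y$. The chase terminates on $D$ if after finitely many rounds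 nothing new is added. The all-instance termination problem is: given $\mathcal T$, does the Semi-Oblivious Chase of $\mathcal T$ terminate on every finite database instance $D$? Theorem. The all-instance termination problem of the Semi-Oblivious Chase, for programs of multi-head TGDs over binary signatures, is undecidable. Moreover, it is r.e.-hard: every recursively enumerable set $A\subseteq\mathbb N$ is many-one reducible to it, i.e. there is a computable function that maps each $n\in\mathbb N$ to a program $\mathcal T_n$ of multi-head TGDs over a binary signature such that $n\in A$ if and only if the Semi-Oblivious Chase of $\mathcal T_n$ terminates on every finite database instance. -/

import Mathlib

/-!
Tuple generating dependencies (TGDs), the Semi-Oblivious Chase and its all-instance termination.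
-/

namespace TGD

/-! ### Syntax -/

/-- An atom `R(v₁, …, vₙ)` over a set `V` of arguments, given by the name of `R` and the list of
arguments.  A relation symbol is a name together with an arity: equal names with argument lists of
different lengths denote different relations. -/
abbrev Atom (V : Type) : Type := ℕ × List V

namespace Atom

variable {V W : Type}

/-- The list of arguments of an atom. -/
def args (A : Atom V) : List V := A.2

/-- The arity of (the relation symbol of) an atom. -/
def arity (A : Atom V) : ℕ := A.2.length

/-- Substitution in an atom. -/
def subst (σ : V → W) (A : Atom V) : Atom W := (A.1, A.2.map σ)

end Atom

/-- A conjunction of positive, equality-free atoms; the variables are natural numbers. -/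
abbrev Conj : Type := List (Atom ℕ)

/-- The variables occurring in a conjunction. -/
def Conj.vars (Φ : Conj) : List ℕ := Φ.flatMap Atom.args

/-- A (multi-head) TGD `Φ(x̄, ȳ) ⇒ ∃ z̄, Ψ(x̄, z̄)`, given by the pair of its body `Φ` and its head
`Ψ`.  The variables `z̄` that occur in the head but not in the body are existentially quantified. -/
abbrev Rule : Type := Conj × Conj

namespace Rule

/-- The body of a TGD. -/
def body (r : Rule) : Conj := r.1

/-- The head of a TGD. -/
def head (r : Rule) : Conj := r.2

/-- The frontier `x̄` of a TGD: the variables that occur in its body and in its head. -/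
def frontier (r : Rule) : List ℕ := r.body.vars.filter (fun v => v ∈ r.head.vars)

end Rule

/-- A program: a finite collection of TGDs, numbered by their position. -/
abbrev Program : Type := List Rule

/-- The programs of multi-head TGDs over binary signatures: bodies and heads are non-empty
conjunctions, and all relation symbols are unary or binary. -/
def IsBinary (P : Program) : Prop :=
  ∀ r ∈ P, r.body ≠ [] ∧ r.head ≠ [] ∧
    (∀ A ∈ r.body, 1 ≤ A.arity ∧ A.arity ≤ 2) ∧ (∀ A ∈ r.head, 1 ≤ A.arity ∧ A.arity ≤ 2)

/-! ### The Semi-Oblivious Chase -/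

/-- The elements of the chase: constants of the database instance, and nulls.  `null i z ā` is the
witness for the existential variable `z` created by the `i`-th TGD for the value `ā` of its
frontier, i.e. the Skolem term `h_{i,z}(ā)`. -/
inductive Term : Type
  | const (c : ℕ) : Term
  | null (i z : ℕ) (args : List Term) : Term

/-- The extension of a valuation `σ` of the body variables of the `i`-th TGD `r` to all its
variables: the existential variables are sent to witnesses that depend only on the values of the
frontier variables. -/
def Rule.extend (r : Rule) (i : ℕ) (σ : ℕ → Term) (v : ℕ) : Term :=
  if v ∈ r.body.vars then σ v else Term.null i v (r.frontier.map σ)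

/-- One round of the Semi-Oblivious Chase: for all TGDs `r` of `P` and all valuations satisfying the
body of `r` in `S`, the corresponding atoms of the head of `r` are added to `S`. -/
def chaseStep (P : Program) (S : Set (Atom Term)) : Set (Atom Term) :=
  S ∪ {F | ∃ (i : ℕ) (r : Rule) (σ : ℕ → Term), P[i]? = some r ∧
    (∀ A ∈ r.body, A.subst σ ∈ S) ∧ ∃ A ∈ r.head, F = A.subst (r.extend i σ)}

/-- The state of the Semi-Oblivious Chase of `P` on the database instance `D` after `n` rounds. -/
def chase (P : Program) (D : Set (Atom ℕ)) : ℕ → Set (Atom Term)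
  | 0 => Atom.subst Term.const '' D
  | n + 1 => chaseStep P (chase P D n)

/-- The Semi-Oblivious Chase of `P` on `D` terminates: after finitely many rounds, nothing new is
added. -/
def ChaseTerminates (P : Program) (D : Set (Atom ℕ)) : Prop :=
  ∃ n, chase P D (n + 1) = chase P D n

/-- All-instance termination: the Semi-Oblivious Chase of `P` terminates on every finite database
instance.  (Facts over relations that do not occur in `P` never take part in the chase.) -/
def AllInstanceTermination (P : Program) : Prop :=
  ∀ D : Set (Atom ℕ), D.Finite → ChaseTerminates P D

/-! ### Binary programs as inputs of algorithms -/

instance : DecidablePred IsBinary := fun P => by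
  unfold IsBinary Conj
  infer_instance

theorem primrecPred_isBinary : PrimrecPred IsBinary := by
  have hA : PrimrecPred fun A : Atom ℕ => 1 ≤ A.arity ∧ A.arity ≤ 2 :=
    PrimrecPred.and
      (Primrec.nat_le.comp (Primrec.const 1) (Primrec.list_length.comp Primrec.snd))
      (Primrec.nat_le.comp (Primrec.list_length.comp Primrec.snd) (Primrec.const 2))
  have hC : PrimrecPred fun Φ : Conj => ∀ A ∈ Φ, 1 ≤ A.arity ∧ A.arity ≤ 2 :=
    hA.forall_mem_list
  have hN : PrimrecPred fun Φ : Conj => Φ ≠ [] :=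
    (Primrec.eq.comp Primrec.id (Primrec.const [])).not
  exact PrimrecPred.forall_mem_list
    ((hN.comp Primrec.fst).and ((hN.comp Primrec.snd).and
      ((hC.comp Primrec.fst).and (hC.comp Primrec.snd))))

/-- The type of programs of multi-head TGDs over binary signatures. -/
abbrev BinaryProgram : Type := {P : Program // IsBinary P}

instance : Primcodable BinaryProgram := Primcodable.subtype primrecPred_isBinary

end TGD

namespace TGD

/-! ### Unary primitive recursive functions -/

/-! For a recursively enumerable set there is a primitive recursive `f` such that `n` belongs to it
iff `f ⟨n, m⟩ ≠ 0` for some `m` (`REPred.exists_primCode`). The program `search c n` looks for such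
an `m` with growing resources. The chase builds a chain of levels. Level `k` has its own copy of the
numbers, in which `m` is a null made from the levels `k - m` and `k`; all numbers from `k` on
coincide. Rules without existential variables compute, on every level, successor, order, the coding
of pairs by `Nat.pair`, and the graphs of all subcodes of `c`. Pairs are nulls with two projections,
so binary relations suffice. The predicate `checked` passes from `j` to `j + 1` only if `f ⟨n, j⟩ =
0`, and a new level appears only when the number at the bottom of a level, namely `k` on level `k`,
has been checked.

If there is no such `m`, then on `startInstance` every level is checked down to its bottom, so
arbitrarily deep terms arise (`not_chaseTerminates_search`). Identifying large numbers only adds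
facts, which is harmless here.

If there is such an `m`, the chase must stop on every database, however irregular its facts.
Constants get level and value `0`, and the relations are read as arithmetic truncated at the level
(`Sem`). Under this reading every database fact is true, and all rules preserve truth. From some
level `K > m` on, the evaluations that matter stay below the level, where truncated arithmetic is
exact. There `checked` cannot go beyond `m`, hence never reaches the bottom, and no level above `K`
is created. Only finitely many terms remain (`chaseTerminates_of_invariant`). -/

/-- Codes of the unary primitive recursive functions. -/
inductive PrimCode : Type
  | zero : PrimCode
  | succ : PrimCode
  | left : PrimCode
  | right : PrimCode
  | pair (f g : PrimCode) : PrimCode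
  | comp (f g : PrimCode) : PrimCode
  | prec (f g : PrimCode) : PrimCode
  deriving Encodable

/-- Primitive recursion with parameter `a`, in terms of the pairing function. -/
def primRec (f g : ℕ → ℕ) (a : ℕ) : ℕ → ℕ
  | 0 => f a
  | n + 1 => g (Nat.pair a (Nat.pair n (primRec f g a n)))

namespace PrimCode

/-- The function computed by a code. -/
def eval : PrimCode → ℕ → ℕ
  | zero, _ => 0
  | succ, x => x + 1
  | left, x => x.unpair.1
  | right, x => x.unpair.2
  | pair f g, x => Nat.pair (f.eval x) (g.eval x)
  | comp f g, x => f.eval (g.eval x)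
  | prec f g, x => primRec f.eval g.eval x.unpair.1 x.unpair.2

theorem exists_eval_eq {f : ℕ → ℕ} (hf : Nat.Primrec f) : ∃ c : PrimCode, c.eval = f := by
  induction hf with
  | zero => exact ⟨zero, rfl⟩
  | succ => exact ⟨succ, rfl⟩
  | left => exact ⟨left, rfl⟩
  | right => exact ⟨right, rfl⟩
  | pair _ _ hf hg =>
    obtain ⟨c, rfl⟩ := hf
    obtain ⟨d, rfl⟩ := hg
    exact ⟨pair c d, rfl⟩
  | comp _ _ hf hg =>
    obtain ⟨c, rfl⟩ := hf
    obtain ⟨d, rfl⟩ := hg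
    exact ⟨comp c d, rfl⟩
  | prec _ _ hf hg =>
    obtain ⟨c, rfl⟩ := hf
    obtain ⟨d, rfl⟩ := hg
    refine ⟨prec c d, funext fun x => ?_⟩
    simp only [eval, Nat.unpaired]
    induction x.unpair.2 with
    | zero => rfl
    | succ n ih => simp only [primRec, ih]

/-- All numbers occurring in the evaluation of the code at `x` are less than `k`. -/
def Fits (k : ℕ) : PrimCode → ℕ → Prop
  | zero, _ => 0 < k
  | succ, x => x + 1 < k
  | left, x => x < k
  | right, x => x < k
  | pair f g, x => f.Fits k x ∧ g.Fits k x ∧ Nat.pair (f.eval x) (g.eval x) < k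
  | comp f g, x => g.Fits k x ∧ f.Fits k (g.eval x)
  | prec f g, x => x < k ∧ f.Fits k x.unpair.1 ∧
      ∀ j < x.unpair.2, Nat.pair x.unpair.1 (Nat.pair j (primRec f.eval g.eval x.unpair.1 j)) < k ∧
        g.Fits k (Nat.pair x.unpair.1 (Nat.pair j (primRec f.eval g.eval x.unpair.1 j)))

open Filter in
theorem eventually_fits (c : PrimCode) (x : ℕ) : ∀ᶠ k in atTop, c.Fits k x := by
  induction c generalizing x with
  | zero => exact eventually_gt_atTop _
  | succ => exact eventually_gt_atTop _
  | left => exact eventually_gt_atTop _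
  | right => exact eventually_gt_atTop _
  | pair f g hf hg => exact (hf x).and ((hg x).and (eventually_gt_atTop _))
  | comp f g hf hg => exact (hg x).and (hf _)
  | prec f g hf hg =>
    refine (eventually_gt_atTop x).and ((hf _).and ?_)
    exact (eventually_all_finite (Set.finite_lt_nat x.unpair.2)).2 fun j _ =>
      (eventually_gt_atTop _).and (hg _)

/-- Constants have level `0`, so a claim about graphs that is conditional on `Fits` holds vacuously
for arbitrary database facts. -/
theorem not_fits_zero (c : PrimCode) (x : ℕ) : ¬ c.Fits 0 x := by
  induction c generalizing x <;> simp_all [Fits]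

end PrimCode

/-- The witness `m` is a bound for the evaluator `evaln`, which is primitive recursive and complete
for the halting of a partial recursive code. -/
theorem _root_.REPred.exists_primCode {p : ℕ → Prop} (hp : REPred p) :
    ∃ c : PrimCode, ∀ n, p n ↔ ∃ m, c.eval (Nat.pair n m) ≠ 0 := by
  obtain ⟨d, hd⟩ := Nat.Partrec.Code.exists_code.1 hp
  have hprim : Primrec fun x : ℕ =>
      (Nat.Partrec.Code.evaln x.unpair.2 d x.unpair.1).isSome.toNat := by
    refine (Primrec.dom_bool Bool.toNat).comp (Primrec.option_isSome.comp ?_)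
    exact Nat.Partrec.Code.primrec_evaln.comp
      (((Primrec.snd.comp Primrec.unpair).pair (Primrec.const d)).pair
        (Primrec.fst.comp Primrec.unpair))
  obtain ⟨c, hc⟩ := PrimCode.exists_eval_eq (Primrec.nat_iff.1 hprim)
  refine ⟨c, fun n => ?_⟩
  have h1 : p n ↔ (d.eval n).Dom := by
    have := congrFun hd n
    rw [this]
    simp only [Encodable.decode_nat, Part.coe_some, Part.bind_some, Part.map_Dom]
    exact ⟨fun h => ⟨h, trivial⟩, fun h => h.1⟩
  rw [h1, Part.dom_iff_mem]
  simp only [hc, Nat.unpair_pair, Nat.Partrec.Code.evaln_complete]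
  rw [exists_comm]
  refine exists_congr fun m => ?_
  cases h : Nat.Partrec.Code.evaln m d n <;> simp

/-! ### Enumeration of pairs -/

/-- `Nat.pair` runs through the shells `(0,b), …, (b-1,b), (b,0), …, (b,b)`. This and the next three
lemmas are the possible successor steps; each becomes one rule for `code`. -/
theorem pair_succ_left {a b : ℕ} (h : a + 1 < b) : Nat.pair (a + 1) b = Nat.pair a b + 1 := by
  simp only [Nat.pair, if_pos h, if_pos (show a < b by omega)]; omega

theorem pair_succ_right {a b : ℕ} (h : b < a) : Nat.pair a (b + 1) = Nat.pair a b + 1 := by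
  simp only [Nat.pair, if_neg (show ¬ a < b + 1 by omega), if_neg (show ¬ a < b by omega)]; omega

theorem pair_zero_right (a : ℕ) : Nat.pair (a + 1) 0 = Nat.pair a (a + 1) + 1 := by
  simp only [Nat.pair, if_neg (show ¬ a + 1 < 0 by omega), if_pos (show a < a + 1 by omega)]; ring

theorem pair_zero_left (a : ℕ) : Nat.pair 0 (a + 1) = Nat.pair a a + 1 := by
  simp only [Nat.pair, if_neg (show ¬ a < a by omega), if_pos (show 0 < a + 1 by omega)]; ring

/-! ### The chase in general -/

/-- `M` is closed under the rule `r`, its existential variables aside. -/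
def Closed (M : Set (Atom Term)) (r : Rule) : Prop :=
  ∀ σ : ℕ → Term, (∀ A ∈ r.body, A.subst σ ∈ M) → ∀ A ∈ r.head, A.subst σ ∈ M

/-- The rule has no existential variables. -/
def Rule.Safe (r : Rule) : Prop := r.head.vars ⊆ r.body.vars

theorem Conj.mem_vars {Φ : Conj} {A : Atom ℕ} {v : ℕ} (hA : A ∈ Φ) (hv : v ∈ A.2) : v ∈ Φ.vars :=
  List.mem_flatMap.2 ⟨A, hA, hv⟩

theorem Rule.Safe.subst_extend {r : Rule} (hr : r.Safe) (i : ℕ) (σ : ℕ → Term) {A : Atom ℕ}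
    (hA : A ∈ r.head) : A.subst (r.extend i σ) = A.subst σ := by
  refine Prod.ext rfl (List.map_congr_left fun v hv => ?_)
  exact if_pos (hr (Conj.mem_vars hA hv))

theorem chase_mono (P : Program) (D : Set (Atom ℕ)) : Monotone (chase P D) :=
  monotone_nat_of_le_succ fun _ => Set.subset_union_left

/-- The result of the chase. -/
def chaseLimit (P : Program) (D : Set (Atom ℕ)) : Set (Atom Term) := ⋃ n, chase P D n

theorem chaseLimit_closed {P : Program} {D : Set (Atom ℕ)} {i : ℕ} {r : Rule} (hr : P[i]? = some r)
    (σ : ℕ → Term) (h : ∀ A ∈ r.body, A.subst σ ∈ chaseLimit P D) :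
    ∀ A ∈ r.head, A.subst (r.extend i σ) ∈ chaseLimit P D := by
  have hn : ∀ Φ : Conj, (∀ A ∈ Φ, A.subst σ ∈ chaseLimit P D) →
      ∃ n, ∀ A ∈ Φ, A.subst σ ∈ chase P D n := by
    intro Φ
    induction Φ with
    | nil => simp
    | cons A Φ ih =>
      intro h
      rw [List.forall_mem_cons] at h
      obtain ⟨m, hm⟩ := ih h.2
      obtain ⟨n, hn⟩ := Set.mem_iUnion.1 h.1
      refine ⟨max m n, List.forall_mem_cons.2 ⟨chase_mono P D (le_max_right m n) hn, fun B hB =>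
        chase_mono P D (le_max_left m n) (hm B hB)⟩⟩
  obtain ⟨n, hn⟩ := hn _ h
  exact fun A hA => Set.mem_iUnion.2 ⟨n + 1, Or.inr ⟨i, r, σ, hr, hn, A, hA, rfl⟩⟩

theorem closed_chaseLimit {P : Program} {D : Set (Atom ℕ)} {r : Rule} (hr : r ∈ P) (hs : r.Safe) :
    Closed (chaseLimit P D) r := by
  intro σ h A hA
  obtain ⟨i, hi⟩ := List.mem_iff_getElem?.1 hr
  rw [← hs.subst_extend i σ hA]
  exact chaseLimit_closed hi σ h A hA

/-- The nesting depth of Skolem functions in a term is at most `n`. -/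
def DepthLE : ℕ → Term → Prop
  | 0, t => ∃ c, t = .const c
  | n + 1, t => (∃ c, t = .const c) ∨ ∃ i z l, t = .null i z l ∧ ∀ u ∈ l, DepthLE n u

theorem DepthLE.succ {n : ℕ} {t : Term} (h : DepthLE n t) : DepthLE (n + 1) t := by
  induction n generalizing t with
  | zero => exact Or.inl h
  | succ n ih =>
    rcases h with h | ⟨i, z, l, rfl, h⟩
    · exact Or.inl h
    · exact Or.inr ⟨i, z, l, rfl, fun u hu => ih (h u hu)⟩

theorem forall_depthLE_of_subst {Φ : Conj} {σ : ℕ → Term} {n : ℕ}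
    (h : ∀ A ∈ Φ, ∀ u ∈ (A.subst σ).2, DepthLE n u) {v : ℕ} (hv : v ∈ Φ.vars) :
    DepthLE n (σ v) := by
  obtain ⟨A, hA, hv⟩ := List.mem_flatMap.1 hv
  exact h A hA _ (List.mem_map_of_mem hv)

theorem depthLE_of_mem_chase {P : Program} {D : Set (Atom ℕ)} {n : ℕ} {F : Atom Term}
    (hF : F ∈ chase P D n) : ∀ u ∈ F.2, DepthLE n u := by
  induction n generalizing F with
  | zero =>
    obtain ⟨A, -, rfl⟩ := hF
    intro u hu
    obtain ⟨c, -, rfl⟩ := List.mem_map.1 hu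
    exact ⟨c, rfl⟩
  | succ n ih =>
    rcases hF with hF | ⟨i, r, σ, hr, hb, A, hA, rfl⟩
    · exact fun u hu => (ih hF u hu).succ
    · intro u hu
      obtain ⟨v, hv, rfl⟩ := List.mem_map.1 hu
      have hd : ∀ v ∈ r.body.vars, DepthLE n (σ v) := fun v hv =>
        forall_depthLE_of_subst (fun A hA => ih (hb A hA)) hv
      unfold Rule.extend
      split_ifs with h
      · exact (hd v h).succ
      · refine Or.inr ⟨i, v, _, rfl, fun u hu => ?_⟩
        obtain ⟨w, hw, rfl⟩ := List.mem_map.1 hu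
        exact hd w (List.mem_filter.1 hw).1

/-- A chase with Skolem terms of unbounded depth does not terminate. -/
theorem not_chaseTerminates {P : Program} {D : Set (Atom ℕ)}
    (h : ∀ n, ∃ F ∈ chaseLimit P D, ∃ u ∈ F.2, ¬ DepthLE n u) : ¬ ChaseTerminates P D := by
  rintro ⟨n, hn⟩
  have hc : ∀ m, chase P D m ⊆ chase P D n := by
    intro m
    induction m with
    | zero => exact chase_mono P D (Nat.zero_le n)
    | succ m ih =>
      rw [← hn]
      rintro F (hF | ⟨i, r, σ, hr, hb, A, hA, rfl⟩)
      · exact Or.inl (ih hF)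
      · exact Or.inr ⟨i, r, σ, hr, fun A hA => ih (hb A hA), A, hA, rfl⟩
  obtain ⟨F, hF, u, hu, hd⟩ := h n
  obtain ⟨m, hm⟩ := Set.mem_iUnion.1 hF
  exact hd (depthLE_of_mem_chase (hc m hm) u hu)

theorem chaseTerminates_of_finite {P : Program} {D : Set (Atom ℕ)} {B : Set (Atom Term)}
    (hB : B.Finite) (h : ∀ n, chase P D n ⊆ B) : ChaseTerminates P D := by
  by_contra hne
  have hlt : ∀ n, n ≤ (chase P D n).ncard := by
    intro n
    induction n with
    | zero => exact Nat.zero_le _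
    | succ n ih =>
      refine Nat.succ_le_of_lt (ih.trans_lt (Set.ncard_lt_ncard ?_ (hB.subset (h _))))
      exact (chase_mono P D n.le_succ).ssubset_of_ne fun he => hne ⟨n, he.symm⟩
  exact absurd ((hlt (B.ncard + 1)).trans (Set.ncard_le_ncard (h _) hB)) (by omega)

/-- The chase of a binary program terminates if its atoms satisfy an invariant, and their arguments
belong to a finite set. -/
theorem chaseTerminates_of_invariant {P : Program} (hP : IsBinary P) {D : Set (Atom ℕ)}
    (hD : D.Finite) {M : Set (Atom Term)} {T : Set Term} (hT : T.Finite)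
    (hDM : ∀ A ∈ D, A.subst Term.const ∈ M) (hDT : ∀ A ∈ D, ∀ c ∈ A.2, Term.const c ∈ T)
    (hM : ∀ (i : ℕ) (r : Rule) (σ : ℕ → Term), P[i]? = some r →
      (∀ v ∈ r.body.vars, σ v ∈ T) → (∀ A ∈ r.body, A.subst σ ∈ M) →
      ∀ A ∈ r.head, A.subst (r.extend i σ) ∈ M ∧ ∀ v ∈ A.2, r.extend i σ v ∈ T) :
    ChaseTerminates P D := by
  let N : Set ℕ := {k | k ∈ P.flatMap fun r => r.head.map Prod.fst}
  have hN : N.Finite := List.finite_toSet _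
  -- Derived atoms have arity at most `2`, so finitely many terms give finitely many of them.
  -- Database facts may have any arity and are kept apart.
  let B : Set (Atom Term) := Atom.subst Term.const '' D ∪
    (Set.image2 (fun k u => (k, [u])) N T ∪
      Set.image2 (fun k (u : Term × Term) => (k, [u.1, u.2])) N (T ×ˢ T))
  have hBfin : B.Finite :=
    (hD.image _).union ((hN.image2 _ hT).union (hN.image2 _ (hT.prod hT)))
  refine chaseTerminates_of_finite hBfin fun n => ?_
  suffices h : ∀ F ∈ chase P D n, (F ∈ M ∧ ∀ u ∈ F.2, u ∈ T) ∧ F ∈ B from fun F hF => (h F hF).2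
  induction n with
  | zero =>
    rintro F ⟨A, hA, rfl⟩
    refine ⟨⟨hDM A hA, fun u hu => ?_⟩, Or.inl ⟨A, hA, rfl⟩⟩
    obtain ⟨c, hc, rfl⟩ := List.mem_map.1 hu
    exact hDT A hA c hc
  | succ n ih =>
    rintro F (hF | ⟨i, r, σ, hr, hb, A, hA, rfl⟩)
    · exact ih F hF
    · have hv : ∀ v ∈ r.body.vars, σ v ∈ T := by
        intro v hv
        obtain ⟨A, hA, hv⟩ := List.mem_flatMap.1 hv
        exact (ih _ (hb A hA)).1.2 _ (List.mem_map_of_mem hv)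
      obtain ⟨h1, h2⟩ := hM i r σ hr hv (fun A hA => (ih _ (hb A hA)).1.1) A hA
      have hmem := List.mem_of_getElem? hr
      refine ⟨⟨h1, List.forall_mem_map.2 h2⟩, Or.inr ?_⟩
      have hAN : A.1 ∈ N := List.mem_flatMap.2 ⟨r, hmem, List.mem_map_of_mem hA⟩
      have har := (hP r hmem).2.2.2 A hA
      obtain ⟨R, l⟩ := A
      rcases l with _ | ⟨u, _ | ⟨v, _ | ⟨w, l⟩⟩⟩
      · simp [Atom.arity] at har
      · exact Or.inl ⟨R, hAN, _, h2 u (by simp), rfl⟩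
      · exact Or.inr ⟨R, hAN, (_, _), ⟨h2 u (by simp), h2 v (by simp)⟩, rfl⟩
      · simp [Atom.arity] at har

/-! ### The program of a code -/

/-- Relation symbols. -/
inductive Symb : Type
  | step : Symb
  | le : Symb
  | bot : Symb
  | top : Symb
  | pos : Symb
  | zero : Symb
  | succ : Symb
  | lt : Symb
  | fst : Symb
  | snd : Symb
  | code : Symb
  | input : Symb
  | checked : Symb
  | graph (c : PrimCode) : Symb
  deriving Encodable

/-- The atom with the given relation symbol and arguments. -/
def Symb.app {V : Type} (R : Symb) (l : List V) : Atom V := (Encodable.encode R, l)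

@[simp]
theorem Symb.arity_app {V : Type} (R : Symb) (l : List V) : (R.app l).arity = l.length := rfl

/-- Body and head are non-empty, and all relation symbols are unary or binary. -/
def Rule.Binary (r : Rule) : Prop :=
  r.body ≠ [] ∧ r.head ≠ [] ∧
    (∀ A ∈ r.body, 1 ≤ A.arity ∧ A.arity ≤ 2) ∧ (∀ A ∈ r.head, 1 ≤ A.arity ∧ A.arity ≤ 2)

open Symb in
/-- Rules that compute the graph of the function of a code from the graph of the pairing
function. -/
def PrimCode.rules : PrimCode → List Rule
  | .zero => [([top.app [0, 1], top.app [2, 1], pos.app [2, 1]], [(graph .zero).app [0, 2]])]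
  | .succ => [([Symb.succ.app [0, 1]], [(graph .succ).app [0, 1]])]
  | .left => [([code.app [0, 1], fst.app [0, 2]], [(graph .left).app [1, 2]])]
  | .right => [([code.app [0, 1], snd.app [0, 2]], [(graph .right).app [1, 2]])]
  | .pair f g =>
    ([(graph f).app [0, 1], (graph g).app [0, 2], fst.app [3, 1], snd.app [3, 2], code.app [3, 4]],
      [(graph (.pair f g)).app [0, 4]]) :: (f.rules ++ g.rules)
  | .comp f g =>
    ([(graph g).app [0, 1], (graph f).app [1, 2]], [(graph (.comp f g)).app [0, 2]]) ::
      (f.rules ++ g.rules)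
  | .prec f g =>
    ([code.app [0, 1], fst.app [0, 2], snd.app [0, 3], Symb.zero.app [3], (graph f).app [2, 4]],
      [(graph (.prec f g)).app [1, 4]]) ::
    ([Symb.succ.app [0, 1],
      fst.app [2, 4], snd.app [2, 0], code.app [2, 5], (graph (.prec f g)).app [5, 6],
      fst.app [7, 0], snd.app [7, 6], code.app [7, 8],
      fst.app [9, 4], snd.app [9, 8], code.app [9, 10], (graph g).app [10, 11],
      fst.app [3, 4], snd.app [3, 1], code.app [3, 12]],
      [(graph (.prec f g)).app [12, 11]]) :: (f.rules ++ g.rules)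

namespace Program

open Symb

/-- The next level is created once the top of the present level has been checked. -/
def growRule : Rule :=
  ([checked.app [0], top.app [0, 1], pos.app [0, 2], bot.app [2]],
    [step.app [1, 3], le.app [3, 3]])

/-- Level `1` gets a copy of the position `0`. -/
def copyRule : Rule := ([le.app [0, 1]], [top.app [2, 1], pos.app [2, 0]])

/-- Pairs of numbers of the same level. -/
def pairRule : Rule := ([top.app [0, 1], top.app [2, 1]], [fst.app [3, 0], snd.app [3, 2]])

/-- The `n`-th number is the input. -/
def inputRule (n : ℕ) : Rule :=
  (zero.app [0] :: (List.range n).map fun i => succ.app [i, i + 1], [input.app [n]])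

/-- Rules for the order and for the pairing function. -/
def arithmeticRules : List Rule :=
  [([step.app [0, 1], le.app [1, 2]], [le.app [0, 2]]),
   ([top.app [0, 1], pos.app [0, 1]], [zero.app [0]]),
   ([top.app [0, 1], pos.app [0, 2], top.app [3, 1], pos.app [3, 4], step.app [4, 2]],
    [succ.app [0, 3]]),
   ([succ.app [0, 1]], [lt.app [0, 1]]),
   ([lt.app [0, 1], succ.app [1, 2]], [lt.app [0, 2]]),
   ([zero.app [0], fst.app [1, 0], snd.app [1, 0]], [code.app [1, 0]]),
   ([code.app [0, 1], succ.app [1, 2], fst.app [0, 3], snd.app [0, 4],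
     succ.app [3, 5], lt.app [5, 4], fst.app [6, 5], snd.app [6, 4]], [code.app [6, 2]]),
   ([code.app [0, 1], succ.app [1, 2], fst.app [0, 3], snd.app [0, 4],
     succ.app [3, 4], zero.app [5], fst.app [6, 4], snd.app [6, 5]], [code.app [6, 2]]),
   ([code.app [0, 1], succ.app [1, 2], fst.app [0, 3], snd.app [0, 3],
     succ.app [3, 4], zero.app [5], fst.app [6, 5], snd.app [6, 4]], [code.app [6, 2]]),
   ([code.app [0, 1], succ.app [1, 2], fst.app [0, 3], snd.app [0, 4],
     lt.app [4, 3], succ.app [4, 5], fst.app [6, 3], snd.app [6, 5]], [code.app [6, 2]])]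

/-- Rules that search for a zero of the function of the code at pairs of the input and a number. -/
def searchRules (c : PrimCode) : List Rule :=
  [([zero.app [0]], [checked.app [0]]),
   ([checked.app [0], succ.app [0, 1], input.app [2], fst.app [3, 2], snd.app [3, 0],
     code.app [3, 4], (graph c).app [4, 5], zero.app [5]], [checked.app [1]])]

/-- The rules without existential variables. -/
def datalogRules (c : PrimCode) (n : ℕ) : List Rule :=
  inputRule n :: (arithmeticRules ++ searchRules c ++ c.rules)

/-- The program that runs until the function of `c` has a value different from zero at a pair with
first component `n`. -/
def search (c : PrimCode) (n : ℕ) : Program :=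
  growRule :: copyRule :: pairRule :: datalogRules c n

/-! ### Shape of the rules: Skolem terms, safety, arities, computability. -/

/-- This is where the semi-oblivious chase matters: the frontier is the level alone, so the checked
number that triggers the rule does not enter the null, and each level has one next level. -/
theorem extend_growRule (σ : ℕ → Term) :
    growRule.extend 0 σ 1 = σ 1 ∧ growRule.extend 0 σ 3 = .null 0 3 [σ 1] := by
  simp [Rule.extend, growRule, Rule.body, Rule.head, Rule.frontier, Conj.vars, Atom.args, Symb.app]

theorem extend_copyRule (σ : ℕ → Term) : copyRule.extend 1 σ 0 = σ 0 ∧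
    copyRule.extend 1 σ 1 = σ 1 ∧ copyRule.extend 1 σ 2 = .null 1 2 [σ 0, σ 1] := by
  simp [Rule.extend, copyRule, Rule.body, Rule.head, Rule.frontier, Conj.vars, Atom.args, Symb.app]

/-- The common level is not in the frontier, so a pair depends on its components only. -/
theorem extend_pairRule (σ : ℕ → Term) : pairRule.extend 2 σ 0 = σ 0 ∧
    pairRule.extend 2 σ 2 = σ 2 ∧ pairRule.extend 2 σ 3 = .null 2 3 [σ 0, σ 2] := by
  simp [Rule.extend, pairRule, Rule.body, Rule.head, Rule.frontier, Conj.vars, Atom.args, Symb.app]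

theorem body_growRule : growRule.body =
    [checked.app [0], top.app [0, 1], pos.app [0, 2], bot.app [2]] := rfl

theorem head_growRule : growRule.head = [step.app [1, 3], le.app [3, 3]] := rfl

theorem body_copyRule : copyRule.body = [le.app [0, 1]] := rfl

theorem head_copyRule : copyRule.head = [top.app [2, 1], pos.app [2, 0]] := rfl

theorem body_pairRule : pairRule.body = [top.app [0, 1], top.app [2, 1]] := rfl

theorem head_pairRule : pairRule.head = [fst.app [3, 0], snd.app [3, 2]] := rfl

theorem safe_of_mem_rules {c : PrimCode} {r : Rule} (hr : r ∈ c.rules) : r.Safe := by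
  induction c with
  | zero | succ | left | right =>
    rw [PrimCode.rules, List.mem_singleton] at hr
    subst hr
    simp [Rule.Safe, Rule.body, Rule.head, Conj.vars, Atom.args, Symb.app]
  | pair f g hf hg | comp f g hf hg =>
    rw [PrimCode.rules, List.mem_cons, List.mem_append] at hr
    rcases hr with rfl | hr | hr
    · simp [Rule.Safe, Rule.body, Rule.head, Conj.vars, Atom.args, Symb.app]
    · exact hf hr
    · exact hg hr
  | prec f g hf hg =>
    rw [PrimCode.rules, List.mem_cons, List.mem_cons, List.mem_append] at hr
    rcases hr with rfl | rfl | hr | hr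
    · simp [Rule.Safe, Rule.body, Rule.head, Conj.vars, Atom.args, Symb.app]
    · simp [Rule.Safe, Rule.body, Rule.head, Conj.vars, Atom.args, Symb.app]
    · exact hf hr
    · exact hg hr

theorem safe_inputRule (n : ℕ) : (inputRule n).Safe := by
  intro v hv
  obtain rfl : v = n := by simpa [inputRule, Rule.head, Conj.vars, Atom.args, Symb.app] using hv
  rcases v with _ | v
  · exact List.mem_flatMap.2 ⟨_, List.mem_cons_self, by simp [Atom.args, Symb.app]⟩
  · exact Conj.mem_vars (A := succ.app [v, v + 1])
      (List.mem_cons_of_mem _ (List.mem_map.2 ⟨v, by simp, rfl⟩)) (by simp [Symb.app])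

theorem safe_of_mem_datalogRules {c : PrimCode} {n : ℕ} {r : Rule} (hr : r ∈ datalogRules c n) :
    r.Safe := by
  simp only [datalogRules, List.mem_cons, List.mem_append] at hr
  rcases hr with rfl | (hr | hr) | hr
  · exact safe_inputRule n
  · revert r
    simp [arithmeticRules, Rule.Safe, Rule.body, Rule.head, Conj.vars, Atom.args, Symb.app]
  · revert r
    simp [searchRules, Rule.Safe, Rule.body, Rule.head, Conj.vars, Atom.args, Symb.app]
  · exact safe_of_mem_rules hr

theorem isBinary_cons {r : Rule} {P : Program} : IsBinary (r :: P) ↔ r.Binary ∧ IsBinary P :=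
  List.forall_mem_cons

theorem isBinary_append {P Q : Program} : IsBinary (P ++ Q) ↔ IsBinary P ∧ IsBinary Q :=
  List.forall_mem_append

theorem isBinary_nil : IsBinary [] := List.forall_mem_nil _

theorem isBinary_rules (c : PrimCode) : IsBinary c.rules := by
  induction c <;>
    simp_all [PrimCode.rules, isBinary_cons, isBinary_append, isBinary_nil, Rule.Binary, Rule.body,
      Rule.head, -Prod.forall]

theorem isBinary_search (c : PrimCode) (n : ℕ) : IsBinary (search c n) := by
  simp [search, datalogRules, growRule, copyRule, pairRule, inputRule, arithmeticRules, searchRules,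
    isBinary_cons, isBinary_rules, Rule.Binary, Rule.body, Rule.head,
    -Prod.forall]

theorem primrec_inputRule : Primrec inputRule := by
  have happ : ∀ (R : Symb) {f : ℕ → List ℕ}, Primrec f → Primrec fun i => R.app (f i) :=
    fun R _ hf => (Primrec.const (Encodable.encode R)).pair hf
  have hsucc : Primrec fun i : ℕ => succ.app [i, i + 1] :=
    happ succ (Primrec.list_cons.comp Primrec.id
      (Primrec.list_cons.comp Primrec.succ (Primrec.const [])))
  have hinput : Primrec fun n : ℕ => input.app [n] :=
    happ input (Primrec.list_cons.comp Primrec.id (Primrec.const []))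
  exact (Primrec.list_cons.comp (Primrec.const _)
    (Primrec.list_map Primrec.list_range (hsucc.comp Primrec.snd).to₂)).pair
      (Primrec.list_cons.comp hinput (Primrec.const []))

/-- The code is fixed, and only `inputRule` depends on `n`; all other rules are constants of the
computation. -/
theorem primrec_search (c : PrimCode) : Primrec (search c) :=
  Primrec.list_cons.comp (Primrec.const _) <| Primrec.list_cons.comp (Primrec.const _) <|
    Primrec.list_cons.comp (Primrec.const _) <|
      Primrec.list_cons.comp primrec_inputRule (Primrec.const _)

theorem computable_search (c : PrimCode) :
    Computable fun n => (⟨search c n, isBinary_search c n⟩ : BinaryProgram) :=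
  (Primrec.subtype_mk (hp := primrecPred_isBinary) (h := isBinary_search c)
    (primrec_search c)).to_comp

end Program

/-! ### Termination -/

/-- The number of the level of a term. -/
def Term.height : Term → ℕ
  | null _ _ (t :: _) => t.height + 1
  | _ => 0

/-- The level of a number. -/
def Term.level : Term → ℕ
  | .null _ _ [_, t] => t.height
  | _ => 0

/-- The value of a number; it is exact if it is less than the level of the number. -/
def Term.value : Term → ℕ
  | .null _ _ [a, t] => t.height - a.height
  | _ => 0

/-- The level of a pair. -/
def Term.pairLevel : Term → ℕ
  | .null _ _ [u, _] => u.level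
  | _ => 0

/-- The value of the first component of a pair. -/
def Term.fstValue : Term → ℕ
  | .null _ _ [u, _] => u.value
  | _ => 0

/-- The value of the second component of a pair. -/
def Term.sndValue : Term → ℕ
  | .null _ _ [_, v] => v.value
  | _ => 0

/-- The `k`-th level over a term. -/
def tower (t : Term) : ℕ → Term
  | 0 => t
  | k + 1 => .null 0 3 [tower t k]

theorem height_tower (c k : ℕ) : (tower (.const c) k).height = k := by
  induction k with
  | zero => rfl
  | succ k ih => rw [tower, Term.height, ih]

/-- The terms for the levels up to `K` over the constants in `C`. -/
def levels (C : Set ℕ) (K : ℕ) : Set Term :=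
  Set.image2 (fun c k => tower (.const c) k) C (Set.Iic K)

/-- The terms for the numbers of the levels up to `K` over the constants in `C`. -/
def numbers (C : Set ℕ) (K : ℕ) : Set Term :=
  Term.const '' C ∪ Set.image2 (fun a t => .null 1 2 [a, t]) (levels C K) (levels C K)

/-- The terms over the constants in `C` that are built up to the level `K`. -/
def terms (C : Set ℕ) (K : ℕ) : Set Term :=
  levels C K ∪ (numbers C K ∪
    Set.image2 (fun u v => .null 2 3 [u, v]) (numbers C K) (numbers C K))

theorem finite_terms {C : Set ℕ} (hC : C.Finite) (K : ℕ) : (terms C K).Finite := by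
  have hl : (levels C K).Finite := hC.image2 _ (Set.finite_Iic K)
  have hn : (numbers C K).Finite := (hC.image _).union (hl.image2 _ hl)
  exact hl.union (hn.union (hn.image2 _ hn))

open Term in
/-- The meaning of the relation symbols, for the input `n`, if `m` is the last number that can be
checked, and the levels from `K` on suffice to evaluate the code. -/
def Sem (C : Set ℕ) (n m K : ℕ) : Symb → List Term → Prop
  | .step, [s, t] => s ∈ levels C K ∧ t ∈ levels C K ∧
      (height t = height s + 1 ∨ height s = 0 ∧ height t = 0)
  | .le, [s, t] => s ∈ levels C K ∧ t ∈ levels C K ∧ height s ≤ height t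
  | .bot, [t] => height t = 0
  | .top, [u, t] => u ∈ numbers C K ∧ t ∈ levels C K ∧ level u = height t
  | .pos, [u, t] => height t ≤ level u ∧ value u = level u - height t
  | .zero, [u] => value u = 0
  | .succ, [u, v] => level u = level v ∧ value v = min (value u + 1) (level v)
  -- The second alternative is forced: a truncated number can be its own successor, hence less than
  -- itself.
  | .lt, [u, v] => level u = level v ∧
      (value u < value v ∨ level v ≤ value u ∧ level v ≤ value v)
  | .fst, [w, u] => pairLevel w = level u ∧ fstValue w = value u
  | .snd, [w, u] => pairLevel w = level u ∧ sndValue w = value u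
  | .code, [w, u] => pairLevel w = level u ∧
      value u = min (Nat.pair (fstValue w) (sndValue w)) (level u)
  | .input, [u] => value u = min n (level u)
  -- Nothing is claimed on levels below `K`, where truncation may have produced false values.
  | .checked, [u] => K ≤ level u → value u ≤ m
  | .graph c, [u, v] => level u = level v ∧
      (c.Fits (level u) (value u) → value v = c.eval (value u))
  -- A relation name with the wrong number of arguments is a different relation, which no rule uses.
  | _, _ => True

/-- All heights, levels and values of constants are `0`, and arithmetic truncated at `0` makes every
relation true. This is what handles arbitrary databases. -/
theorem sem_const {C : Set ℕ} {n m K : ℕ} (R : Symb) {l : List ℕ} (hl : ∀ c ∈ l, c ∈ C) :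
    Sem C n m K R (l.map Term.const) := by
  have h1 : ∀ c ∈ C, Term.const c ∈ levels C K := fun c hc => ⟨c, hc, 0, Nat.zero_le K, rfl⟩
  have h2 : ∀ c ∈ C, Term.const c ∈ numbers C K := fun c hc => Or.inl ⟨c, hc, rfl⟩
  rcases l with _ | ⟨u, _ | ⟨v, _ | ⟨w, l⟩⟩⟩ <;> cases R <;>
    simp_all [Sem, Term.height, Term.level, Term.value, Term.pairLevel, Term.fstValue,
      Term.sndValue, PrimCode.not_fits_zero]

/-- The atoms that are true under the intended meaning of the relation symbols. -/
def Model (C : Set ℕ) (n m K : ℕ) : Set (Atom Term) :=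
  {F | ∀ R : Symb, F.1 = Encodable.encode R → Sem C n m K R F.2}

/-! ### Soundness of the rules without existential variables. -/

theorem app_subst_mem_model {C : Set ℕ} {n m K : ℕ} {R : Symb} {l : List ℕ} {σ : ℕ → Term} :
    (R.app l).subst σ ∈ Model C n m K ↔ Sem C n m K R (l.map σ) := by
  refine ⟨fun h => h R rfl, fun h R' hR => ?_⟩
  obtain rfl : R = R' := Encodable.encode_injective hR
  exact h

/-- `Fits` bounds every intermediate number by the level, so each truncated code met in the
evaluation is exact and the rules compute true values. -/
theorem closed_rules (C : Set ℕ) (n m K : ℕ) (c : PrimCode) :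
    ∀ r ∈ c.rules, Closed (Model C n m K) r := by
  induction c with
  | zero =>
    simp only [PrimCode.rules, List.forall_mem_singleton]
    intro σ h
    simp only [Rule.body, Rule.head, List.forall_mem_cons, List.not_mem_nil, false_imp_iff,
      implies_true, and_true, app_subst_mem_model, List.map_cons, List.map_nil, Sem] at h ⊢
    obtain ⟨h1, h2, h3⟩ := h
    refine ⟨by omega, fun _ => ?_⟩
    simp only [PrimCode.eval]
    omega
  | succ =>
    simp only [PrimCode.rules, List.forall_mem_singleton]
    intro σ h
    simp only [Rule.body, Rule.head, List.forall_mem_cons, List.not_mem_nil, false_imp_iff,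
      implies_true, and_true, app_subst_mem_model, List.map_cons, List.map_nil, Sem] at h ⊢
    refine ⟨h.1, fun hf => ?_⟩
    simp only [PrimCode.eval, PrimCode.Fits] at hf ⊢
    omega
  | left =>
    simp only [PrimCode.rules, List.forall_mem_singleton]
    intro σ h
    simp only [Rule.body, Rule.head, List.forall_mem_cons, List.not_mem_nil, false_imp_iff,
      implies_true, and_true, app_subst_mem_model, List.map_cons, List.map_nil, Sem] at h ⊢
    refine ⟨by omega, fun hf => ?_⟩
    simp only [PrimCode.eval, PrimCode.Fits] at hf ⊢
    rw [show (σ 1).value = Nat.pair (σ 0).fstValue (σ 0).sndValue by omega, Nat.unpair_pair, h.2.2]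
  | right =>
    simp only [PrimCode.rules, List.forall_mem_singleton]
    intro σ h
    simp only [Rule.body, Rule.head, List.forall_mem_cons, List.not_mem_nil, false_imp_iff,
      implies_true, and_true, app_subst_mem_model, List.map_cons, List.map_nil, Sem] at h ⊢
    refine ⟨by omega, fun hf => ?_⟩
    simp only [PrimCode.eval, PrimCode.Fits] at hf ⊢
    rw [show (σ 1).value = Nat.pair (σ 0).fstValue (σ 0).sndValue by omega, Nat.unpair_pair, h.2.2]
  | pair f g hf hg =>
    simp only [PrimCode.rules, List.forall_mem_cons, List.forall_mem_append]
    refine ⟨fun σ h => ?_, hf, hg⟩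
    simp only [Rule.body, Rule.head, List.forall_mem_cons, List.not_mem_nil, false_imp_iff,
      implies_true, and_true, app_subst_mem_model, List.map_cons, List.map_nil, Sem] at h ⊢
    obtain ⟨⟨h1, h1'⟩, ⟨h2, h2'⟩, ⟨h3, h3'⟩, ⟨h4, h4'⟩, h5, h5'⟩ := h
    refine ⟨by omega, fun ⟨hf, hg, hk⟩ => ?_⟩
    rw [h3', h4', h1' hf, h2' hg] at h5'
    simp only [PrimCode.eval]
    omega
  | comp f g hf hg =>
    simp only [PrimCode.rules, List.forall_mem_cons, List.forall_mem_append]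
    refine ⟨fun σ h => ?_, hf, hg⟩
    simp only [Rule.body, Rule.head, List.forall_mem_cons, List.not_mem_nil, false_imp_iff,
      implies_true, and_true, app_subst_mem_model, List.map_cons, List.map_nil, Sem] at h ⊢
    obtain ⟨⟨h1, h1'⟩, h2, h2'⟩ := h
    refine ⟨by omega, fun ⟨hg, hf⟩ => ?_⟩
    rw [h1' hg, ← h1] at h2'
    exact h2' hf
  | prec f g hf hg =>
    simp only [PrimCode.rules, List.forall_mem_cons, List.forall_mem_append]
    refine ⟨fun σ h => ?_, fun σ h => ?_, hf, hg⟩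
    · simp only [Rule.body, Rule.head, List.forall_mem_cons, List.not_mem_nil, false_imp_iff,
        implies_true, and_true, app_subst_mem_model, List.map_cons, List.map_nil, Sem] at h ⊢
      obtain ⟨⟨h1, h1'⟩, ⟨h2, h2'⟩, ⟨h3, h3'⟩, h4, h5, h5'⟩ := h
      refine ⟨by omega, fun ⟨hx, hf, _⟩ => ?_⟩
      have hx' : (σ 1).value = Nat.pair (σ 2).value 0 := by
        rw [h2', h3', h4] at h1'
        omega
      simp only [PrimCode.eval, hx', Nat.unpair_pair, primRec] at hf ⊢
      rw [show (σ 1).level = (σ 2).level by omega] at hf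
      exact h5' hf
    · simp only [Rule.body, Rule.head, List.forall_mem_cons, List.not_mem_nil, false_imp_iff,
        implies_true, and_true, app_subst_mem_model, List.map_cons, List.map_nil, Sem] at h ⊢
      obtain ⟨⟨e0, s0⟩, ⟨e1, s1⟩, ⟨e2, s2⟩, ⟨e3, s3⟩, ⟨e4, s4⟩, ⟨e5, s5⟩, ⟨e6, s6⟩, ⟨e7, s7⟩,
        ⟨e8, s8⟩, ⟨e9, s9⟩, ⟨e10, s10⟩, ⟨e11, s11⟩, ⟨e12, s12⟩, ⟨e13, s13⟩, e14, s14⟩ := h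
      refine ⟨by omega, fun ⟨hx, hf, hs⟩ => ?_⟩
      have hx' : (σ 12).value = Nat.pair (σ 4).value (σ 1).value := by
        rw [s12, s13] at s14
        omega
      have hle := Nat.right_le_pair (σ 4).value (σ 1).value
      have hsucc : (σ 1).value = (σ 0).value + 1 := by omega
      -- The argument of the recursive call is smaller than the present one, which fits; so its code
      -- is exact too.
      have hlt : Nat.pair (σ 4).value (σ 0).value < Nat.pair (σ 4).value (σ 1).value :=
        Nat.pair_lt_pair_right _ (by omega)
      have hy : (σ 5).value = Nat.pair (σ 4).value (σ 0).value := by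
        rw [s1, s2] at s3
        omega
      simp only [hx', Nat.unpair_pair, hsucc] at hf hs
      have hi : (σ 6).value = primRec f.eval g.eval (σ 4).value (σ 0).value := by
        have := s4
        simp only [PrimCode.eval, PrimCode.Fits, hy, Nat.unpair_pair] at this
        refine this ⟨by omega, ?_, fun j hj => ?_⟩
        · rwa [show (σ 5).level = (σ 12).level by omega]
        · rw [show (σ 5).level = (σ 12).level by omega]
          exact hs j (by omega)
      obtain ⟨hk, hg⟩ := hs _ (Nat.lt_succ_self _)
      -- The inner pair is at most the outer one, which fits by `hk`; hence both codes are exact.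
      have hle' := Nat.right_le_pair (σ 4).value
        (Nat.pair (σ 0).value (primRec f.eval g.eval (σ 4).value (σ 0).value))
      rw [s5, s6, hi] at s7
      have h8 : (σ 8).value = Nat.pair (σ 0).value
          (primRec f.eval g.eval (σ 4).value (σ 0).value) := by omega
      rw [s8, s9, h8] at s10
      have h10 : (σ 10).value = Nat.pair (σ 4).value (Nat.pair (σ 0).value
          (primRec f.eval g.eval (σ 4).value (σ 0).value)) := by omega
      rw [show (σ 12).level = (σ 10).level by omega, ← h10] at hg
      rw [s11 hg, h10]
      simp only [PrimCode.eval, hx', Nat.unpair_pair, hsucc, primRec]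

open Program

theorem closed_inputRule (C : Set ℕ) (n m K : ℕ) : Closed (Model C n m K) (inputRule n) := by
  intro σ h
  simp only [Rule.body, Rule.head, inputRule, List.forall_mem_cons, List.not_mem_nil, false_imp_iff,
    implies_true, and_true, app_subst_mem_model, List.map_cons, List.map_nil, Sem,
    List.forall_mem_map, List.mem_range] at h ⊢
  obtain ⟨h0, hs⟩ := h
  -- The conclusion concerns only `n`, but the chain of successors has to be followed from `0`.
  suffices ∀ i ≤ n, (σ i).value = min i (σ i).level from this n le_rfl
  intro i
  induction i with
  | zero => simp [h0]
  | succ i ih =>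
    intro hi
    have := ih (by omega)
    have := hs i (by omega)
    omega

theorem closed_arithmeticRules (C : Set ℕ) (n m K : ℕ) :
    ∀ r ∈ arithmeticRules, Closed (Model C n m K) r := by
  simp only [arithmeticRules, List.forall_mem_cons, List.not_mem_nil, false_imp_iff,
    implies_true, and_true]
  have hl := Nat.left_le_pair
  have hr := Nat.right_le_pair
  refine ⟨?_, ?_, ?_, ?_, ?_, ?_, ?_, ?_, ?_, ?_⟩ <;> intro σ h <;>
    simp only [Rule.body, Rule.head, List.forall_mem_cons, List.not_mem_nil, false_imp_iff,
      implies_true, and_true, app_subst_mem_model, List.map_cons, List.map_nil, Sem] at h ⊢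
  · exact ⟨h.1.1, h.2.2.1, by omega⟩
  · omega
  · omega
  · omega
  · omega
  · obtain ⟨h0, ⟨h1, h2⟩, h3, h4⟩ := h
    refine ⟨h1, ?_⟩
    rw [h2, h4, h0]
    simp [Nat.pair]
  · obtain ⟨⟨e0, s0⟩, ⟨e1, s1⟩, ⟨e2, s2⟩, ⟨e3, s3⟩, ⟨e4, s4⟩, ⟨e5, s5⟩, ⟨e6, s6⟩, ⟨e7, s7⟩⟩ := h
    refine ⟨by omega, ?_⟩
    rw [s6, s7]
    rw [s2, s3] at s0
    have := hr (σ 3).value (σ 4).value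
    have := hr (σ 5).value (σ 4).value
    -- If the comparison fails, `lt` can hold only because both numbers are truncated. A pair is at
    -- least each of its components, so the old and the new code are then both equal to the level.
    -- The other rules for `code` are treated alike.
    rcases lt_or_ge ((σ 3).value + 1) (σ 4).value with h | h
    · have := pair_succ_left h
      rcases le_total ((σ 3).value + 1) (σ 5).level with h' | h'
      · rw [show (σ 5).value = (σ 3).value + 1 by omega, this]
        omega
      · omega
    · omega
  · obtain ⟨⟨e0, s0⟩, ⟨e1, s1⟩, ⟨e2, s2⟩, ⟨e3, s3⟩, ⟨e4, s4⟩, h5, ⟨e6, s6⟩, ⟨e7, s7⟩⟩ := h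
    refine ⟨by omega, ?_⟩
    rw [s6, s7, h5]
    rw [s2, s3] at s0
    have := hr (σ 3).value (σ 4).value
    have := hl (σ 4).value 0
    have := pair_zero_right (σ 3).value
    rcases le_total ((σ 3).value + 1) (σ 4).level with h' | h'
    · rw [show (σ 4).value = (σ 3).value + 1 by omega] at s0 ⊢
      omega
    · omega
  · obtain ⟨⟨e0, s0⟩, ⟨e1, s1⟩, ⟨e2, s2⟩, ⟨e3, s3⟩, ⟨e4, s4⟩, h5, ⟨e6, s6⟩, ⟨e7, s7⟩⟩ := h
    refine ⟨by omega, ?_⟩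
    rw [s6, s7, h5]
    rw [s2, s3] at s0
    have := hr (σ 3).value (σ 3).value
    have := hr 0 (σ 4).value
    have := pair_zero_left (σ 3).value
    rcases le_total ((σ 3).value + 1) (σ 4).level with h' | h'
    · rw [show (σ 4).value = (σ 3).value + 1 by omega]
      omega
    · omega
  · obtain ⟨⟨e0, s0⟩, ⟨e1, s1⟩, ⟨e2, s2⟩, ⟨e3, s3⟩, ⟨e4, s4⟩, ⟨e5, s5⟩, ⟨e6, s6⟩, ⟨e7, s7⟩⟩ := h
    refine ⟨by omega, ?_⟩
    rw [s6, s7]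
    rw [s2, s3] at s0
    have := hl (σ 3).value (σ 4).value
    have := hr (σ 3).value (σ 4).value
    have := hl (σ 3).value (σ 5).value
    have := hr (σ 3).value (σ 5).value
    rcases lt_or_ge (σ 4).value (σ 3).value with h | h
    · have := pair_succ_right h
      rcases le_total ((σ 4).value + 1) (σ 5).level with h' | h'
      · rw [show (σ 5).value = (σ 4).value + 1 by omega, this]
        omega
      · omega
    · omega

theorem closed_searchRules (C : Set ℕ) {n m K : ℕ} {c : PrimCode} (hn : n < K) (hm : m < K)
    (hc : ∀ k ≥ K, ∀ j ≤ m, Nat.pair n j < k ∧ c.Fits k (Nat.pair n j))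
    (h0 : c.eval (Nat.pair n m) ≠ 0) : ∀ r ∈ searchRules c, Closed (Model C n m K) r := by
  simp only [searchRules, List.forall_mem_cons, List.not_mem_nil, false_imp_iff, implies_true,
    and_true]
  refine ⟨fun σ h => ?_, fun σ h => ?_⟩ <;>
    simp only [Rule.body, Rule.head, List.forall_mem_cons, List.not_mem_nil, false_imp_iff,
      implies_true, and_true, app_subst_mem_model, List.map_cons, List.map_nil, Sem] at h ⊢
  · omega
  · obtain ⟨h0, ⟨e1, s1⟩, h2, ⟨e3, s3⟩, ⟨e4, s4⟩, ⟨e5, s5⟩, ⟨e6, s6⟩, h7⟩ := h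
    intro hK
    have hj := h0 (by omega)
    obtain ⟨hp, hf⟩ := hc (σ 4).level (by omega) _ hj
    have h4 : (σ 4).value = Nat.pair n (σ 0).value := by
      rw [s3, s4, show (σ 2).value = n by omega] at s5
      omega
    rw [← h4] at hf
    have := s6 hf
    -- At `m` the exact value of the code is nonzero, contrary to the `zero` atom; so `checked`
    -- cannot pass from `m` to `m + 1`.
    have : (σ 0).value ≠ m := by
      rintro rfl
      rw [h4] at this
      omega
    omega

theorem chaseTerminates_search {n m : ℕ} {c : PrimCode} (h0 : c.eval (Nat.pair n m) ≠ 0)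
    {D : Set (Atom ℕ)} (hD : D.Finite) : ChaseTerminates (search c n) D := by
  -- From level `K` on, the evaluations at all pairs `(n, j)` with `j ≤ m` are exact, and `m` lies
  -- strictly above the bottom.
  obtain ⟨K, hK⟩ := Filter.eventually_atTop.1 (show ∀ᶠ k in Filter.atTop, n < k ∧ m < k ∧
      ∀ j ≤ m, Nat.pair n j < k ∧ c.Fits k (Nat.pair n j) from
    (Filter.eventually_gt_atTop n).and <| (Filter.eventually_gt_atTop m).and <|
      (Filter.eventually_all_finite (Set.finite_le_nat m)).2 fun j _ =>
        (Filter.eventually_gt_atTop _).and (c.eventually_fits _))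
  obtain ⟨hn, hm, -⟩ := hK K le_rfl
  have hdatalog : ∀ r ∈ datalogRules c n, ∀ C, Closed (Model C n m K) r := by
    intro r hr C
    simp only [datalogRules, List.mem_cons, List.mem_append] at hr
    rcases hr with rfl | (hr | hr) | hr
    · exact closed_inputRule C n m K
    · exact closed_arithmeticRules C n m K r hr
    · exact closed_searchRules C hn hm (fun k hk => (hK k hk).2.2) h0 r hr
    · exact closed_rules C n m K c r hr
  let C : Set ℕ := ⋃ A ∈ D, {v | v ∈ A.2}
  have hC : C.Finite := hD.biUnion fun A _ => List.finite_toSet A.2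
  have hDC : ∀ A ∈ D, ∀ v ∈ A.2, v ∈ C := fun A hA v hv => Set.mem_biUnion hA hv
  refine chaseTerminates_of_invariant (isBinary_search c n) hD (finite_terms hC K)
    (M := Model C n m K) (fun A hA R _ => sem_const R (hDC A hA))
    (fun A hA v hv => Or.inr (Or.inl (Or.inl ⟨v, hDC A hA v hv, rfl⟩))) ?_
  intro i r σ hr hv hb
  match i, hr with
  | 0, hr =>
    obtain rfl : growRule = r := by simpa [search] using hr
    obtain ⟨e1, e3⟩ := extend_growRule σ
    simp only [body_growRule, head_growRule, List.forall_mem_cons, List.not_mem_nil,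
      false_imp_iff, implies_true, and_true, app_subst_mem_model, List.map_cons, List.map_nil,
      Sem, e1, e3] at hb ⊢
    obtain ⟨h1, ⟨h2, h3, h4⟩, ⟨h5, h6⟩, h7⟩ := hb
    have h8 : Term.null 0 3 [σ 1] ∈ levels C K := by
      obtain ⟨d, hd, k, hk, h3⟩ := h3
      refine ⟨d, hd, k + 1, ?_, by rw [← h3]; rfl⟩
      -- The checked number has a position of height `0`, so its value is its level `k`. If `K ≤ k`,
      -- then `checked` gives `k ≤ m < K`. Hence `k < K`, and the new level is at most `K`.
      rw [← h3, height_tower] at h4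
      rw [Set.mem_Iic] at hk ⊢
      omega
    refine ⟨⟨⟨h3, h8, Or.inl rfl⟩, ?_⟩, ⟨h8, h8, le_rfl⟩, ?_⟩ <;>
      simp [Symb.app, e1, e3, terms, h3, h8]
  | 1, hr =>
    obtain rfl : copyRule = r := by simpa [search] using hr
    obtain ⟨e0, e1, e2⟩ := extend_copyRule σ
    simp only [body_copyRule, head_copyRule, List.forall_mem_cons, List.not_mem_nil,
      false_imp_iff, implies_true, and_true, app_subst_mem_model, List.map_cons, List.map_nil,
      Sem, e0, e1, e2] at hb ⊢
    obtain ⟨h0, h1, h2⟩ := hb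
    have h3 : Term.null 1 2 [σ 0, σ 1] ∈ numbers C K := Or.inr ⟨_, h0, _, h1, rfl⟩
    refine ⟨⟨⟨h3, h1, rfl⟩, ?_⟩, ⟨h2, rfl⟩, ?_⟩ <;>
      simp [Symb.app, e0, e1, e2, terms, h0, h1, h3]
  | 2, hr =>
    obtain rfl : pairRule = r := by simpa [search] using hr
    obtain ⟨e0, e2, e3⟩ := extend_pairRule σ
    simp only [body_pairRule, head_pairRule, List.forall_mem_cons, List.not_mem_nil,
      false_imp_iff, implies_true, and_true, app_subst_mem_model, List.map_cons, List.map_nil,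
      Sem, e0, e2, e3] at hb ⊢
    obtain ⟨⟨h0, h1, h2⟩, h3, h4, h5⟩ := hb
    have h6 : Term.null 2 3 [σ 0, σ 2] ∈ terms C K := Or.inr (Or.inr ⟨_, h0, _, h3, rfl⟩)
    have h7 : σ 0 ∈ terms C K := Or.inr (Or.inl h0)
    have h8 : σ 2 ∈ terms C K := Or.inr (Or.inl h3)
    refine ⟨⟨⟨rfl, rfl⟩, ?_⟩, ⟨h2.trans h5.symm, rfl⟩, ?_⟩ <;>
      simp [Symb.app, e0, e2, e3, h6, h7, h8]
  | i + 3, hr =>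
    have hr' : r ∈ datalogRules c n := List.mem_of_getElem? (i := i) (by simpa [search] using hr)
    have hs := safe_of_mem_datalogRules hr'
    intro A hA
    rw [hs.subst_extend _ σ hA]
    refine ⟨hdatalog r hr' C σ hb A hA, fun v hv' => ?_⟩
    have := hs (Conj.mem_vars hA hv')
    rw [Rule.extend, if_pos this]
    exact hv v this

open Program Symb

/-! ### Non-termination -/

/-- An instance on which the program of a code simulates the code. -/
def startInstance : Set (Atom ℕ) := {step.app [0, 0], le.app [0, 0], bot.app [0]}

/-- The `k`-th level over the constant `0`. -/
abbrev levelTerm (k : ℕ) : Term := tower (.const 0) k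

/-- The number `m` on the level `k`; the numbers from `k` on coincide. -/
def numberTerm (k m : ℕ) : Term := .null 1 2 [levelTerm (k - m), levelTerm k]

/-- The pair of two numbers on the level `k`. -/
def pairTerm (k a b : ℕ) : Term := .null 2 3 [numberTerm k a, numberTerm k b]

/-- The valuation given by a list. -/
def valuation (l : List Term) (v : ℕ) : Term := l.getD v (.const 0)

theorem Closed.app {M : Set (Atom Term)} {Φ : Conj} {R : Symb} {a : List ℕ}
    (h : Closed M (Φ, [R.app a])) (l : List Term) (hΦ : ∀ A ∈ Φ, A.subst (valuation l) ∈ M) :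
    R.app (a.map (valuation l)) ∈ M :=
  h (valuation l) hΦ _ (List.mem_singleton_self _)

theorem Symb.subst_app {V W : Type} (R : Symb) (l : List V) (σ : V → W) :
    (R.app l).subst σ = R.app (l.map σ) := rfl

/-- The facts on which the numbers of the level `k` depend. -/
structure HasLevel (M : Set (Atom Term)) (k : ℕ) : Prop where
  le_self : le.app [levelTerm k, levelTerm k] ∈ M
  step_zero : step.app [levelTerm 0, levelTerm 0] ∈ M
  step_lt : ∀ i < k, step.app [levelTerm i, levelTerm (i + 1)] ∈ M

/-- The facts on which the evaluation of codes on the level `k` depends. -/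
structure HasNumbers (M : Set (Atom Term)) (k : ℕ) : Prop where
  top : ∀ m, top.app [numberTerm k m, levelTerm k] ∈ M
  pos : ∀ m, pos.app [numberTerm k m, levelTerm (k - m)] ∈ M
  succ : ∀ m, succ.app [numberTerm k m, numberTerm k (m + 1)] ∈ M
  zero : zero.app [numberTerm k 0] ∈ M
  fst : ∀ a b, fst.app [pairTerm k a b, numberTerm k a] ∈ M
  snd : ∀ a b, snd.app [pairTerm k a b, numberTerm k b] ∈ M
  code : ∀ a b, code.app [pairTerm k a b, numberTerm k (Nat.pair a b)] ∈ M

/-- No bound on `x` is needed: `numberTerm k` maps all of `ℕ` onto the numbers of the level and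
preserves the basic relations, so the evaluation in `ℕ` can be replayed on the images. -/
theorem HasNumbers.graph {M : Set (Atom Term)} {k : ℕ} (hM : HasNumbers M k) {c : PrimCode}
    (hc : ∀ r ∈ c.rules, Closed M r) (x : ℕ) :
    (graph c).app [numberTerm k x, numberTerm k (c.eval x)] ∈ M := by
  induction c generalizing x with
  | zero =>
    simp only [PrimCode.rules, List.forall_mem_singleton] at hc
    refine hc.app [numberTerm k x, levelTerm k, numberTerm k 0] ?_
    simpa [subst_app, valuation, -Prod.forall] using ⟨hM.top x, hM.top 0, hM.pos 0⟩
  | succ =>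
    simp only [PrimCode.rules, List.forall_mem_singleton] at hc
    refine hc.app [numberTerm k x, numberTerm k (x + 1)] ?_
    simpa [subst_app, valuation, -Prod.forall] using hM.succ x
  | left =>
    simp only [PrimCode.rules, List.forall_mem_singleton] at hc
    refine hc.app [pairTerm k x.unpair.1 x.unpair.2, numberTerm k x, numberTerm k x.unpair.1] ?_
    have := hM.code x.unpair.1 x.unpair.2
    rw [Nat.pair_unpair] at this
    simpa [subst_app, valuation, -Prod.forall] using ⟨this, hM.fst _ _⟩
  | right =>
    simp only [PrimCode.rules, List.forall_mem_singleton] at hc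
    refine hc.app [pairTerm k x.unpair.1 x.unpair.2, numberTerm k x, numberTerm k x.unpair.2] ?_
    have := hM.code x.unpair.1 x.unpair.2
    rw [Nat.pair_unpair] at this
    simpa [subst_app, valuation, -Prod.forall] using ⟨this, hM.snd _ _⟩
  | pair f g hf hg =>
    simp only [PrimCode.rules, List.forall_mem_cons, List.forall_mem_append] at hc
    refine hc.1.app [numberTerm k x, numberTerm k (f.eval x), numberTerm k (g.eval x),
      pairTerm k (f.eval x) (g.eval x), numberTerm k (Nat.pair (f.eval x) (g.eval x))] ?_
    simpa [subst_app, valuation, -Prod.forall] using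
      ⟨hf hc.2.1 x, hg hc.2.2 x, hM.fst _ _, hM.snd _ _, hM.code _ _⟩
  | comp f g hf hg =>
    simp only [PrimCode.rules, List.forall_mem_cons, List.forall_mem_append] at hc
    refine hc.1.app [numberTerm k x, numberTerm k (g.eval x), numberTerm k (f.eval (g.eval x))] ?_
    simpa [subst_app, valuation, -Prod.forall] using ⟨hg hc.2.2 x, hf hc.2.1 _⟩
  | prec f g hf hg =>
    simp only [PrimCode.rules, List.forall_mem_cons, List.forall_mem_append] at hc
    obtain ⟨h1, h2, hcf, hcg⟩ := hc
    suffices ∀ a n, (Symb.graph (f.prec g)).app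
        [numberTerm k (Nat.pair a n), numberTerm k (primRec f.eval g.eval a n)] ∈ M by
      simpa [PrimCode.eval] using this x.unpair.1 x.unpair.2
    intro a n
    induction n with
    | zero =>
      refine h1.app [pairTerm k a 0, numberTerm k (Nat.pair a 0), numberTerm k a, numberTerm k 0,
        numberTerm k (f.eval a)] ?_
      simpa [subst_app, valuation, -Prod.forall] using
        ⟨hM.code _ _, hM.fst _ _, hM.snd _ _, hM.zero, hf hcf a⟩
    | succ n ih =>
      let i := primRec f.eval g.eval a n
      refine h2.app [numberTerm k n, numberTerm k (n + 1), pairTerm k a n, pairTerm k a (n + 1),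
        numberTerm k a, numberTerm k (Nat.pair a n), numberTerm k i, pairTerm k n i,
        numberTerm k (Nat.pair n i), pairTerm k a (Nat.pair n i),
        numberTerm k (Nat.pair a (Nat.pair n i)), numberTerm k (primRec f.eval g.eval a (n + 1)),
        numberTerm k (Nat.pair a (n + 1))] ?_
      simpa [subst_app, valuation, -Prod.forall] using
        ⟨hM.succ n, hM.fst _ _, hM.snd _ _, hM.code _ _, ih, hM.fst _ _, hM.snd _ _, hM.code _ _,
          hM.fst _ _, hM.snd _ _, hM.code _ _, hg hcg _, hM.fst _ _, hM.snd _ _, hM.code _ _⟩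

section

variable {c : PrimCode} {n : ℕ} {D : Set (Atom ℕ)} {k : ℕ}

theorem closed_of_mem_datalogRules {r : Rule} (hr : r ∈ datalogRules c n) :
    Closed (chaseLimit (search c n) D) r :=
  closed_chaseLimit (List.mem_cons_of_mem _ (List.mem_cons_of_mem _ (List.mem_cons_of_mem _ hr)))
    (safe_of_mem_datalogRules hr)

/-- Walking down from level `k` along `step`, and then around the loop at level `0`, meets the
position of every number; the copies, the pairs and the arithmetic follow. -/
theorem HasLevel.hasNumbers (h : HasLevel (chaseLimit (search c n) D) k) :
    HasNumbers (chaseLimit (search c n) D) k := by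
  have hA : ∀ r ∈ arithmeticRules, Closed (chaseLimit (search c n) D) r := fun r hr =>
    closed_of_mem_datalogRules (by simp [datalogRules, hr])
  simp only [arithmeticRules, List.forall_mem_cons] at hA
  obtain ⟨hle, hzero, hsucc, hlt, hlt', hcode, hcode1, hcode2, hcode3, hcode4, -⟩ := hA
  set M := chaseLimit (search c n) D with hMdef
  have step : ∀ m, step.app [levelTerm (k - (m + 1)), levelTerm (k - m)] ∈ M := by
    intro m
    rcases lt_or_ge m k with hm | hm
    · have := h.step_lt (k - (m + 1)) (by omega)
      rwa [show k - (m + 1) + 1 = k - m by omega] at this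
    -- Truncated subtraction matches the loop at the bottom: all later positions are level `0`.
    · rw [show k - (m + 1) = 0 by omega, show k - m = 0 by omega]
      exact h.step_zero
  have le : ∀ m, le.app [levelTerm (k - m), levelTerm k] ∈ M := by
    intro m
    induction m with
    | zero => exact h.le_self
    | succ m ih =>
      refine hle.app [levelTerm (k - (m + 1)), levelTerm (k - m), levelTerm k] ?_
      simpa [subst_app, valuation, -Prod.forall] using ⟨step m, ih⟩
  have number : ∀ m, top.app [numberTerm k m, levelTerm k] ∈ M ∧
      pos.app [numberTerm k m, levelTerm (k - m)] ∈ M := by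
    intro m
    have := chaseLimit_closed (P := search c n) (D := D) (i := 1) (r := copyRule) rfl
      (valuation [levelTerm (k - m), levelTerm k])
      (by simpa [body_copyRule, subst_app, valuation, -Prod.forall] using le m)
    obtain ⟨e0, e1, e2⟩ := extend_copyRule (valuation [levelTerm (k - m), levelTerm k])
    simp only [head_copyRule, subst_app, e0, e1, e2, List.forall_mem_cons, List.map_cons,
      List.map_nil] at this
    exact ⟨this.1, this.2.1⟩
  have top m := (number m).1
  have pos m := (number m).2
  have pair : ∀ a b, fst.app [pairTerm k a b, numberTerm k a] ∈ M ∧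
      snd.app [pairTerm k a b, numberTerm k b] ∈ M := by
    intro a b
    have := chaseLimit_closed (P := search c n) (D := D) (i := 2) (r := pairRule) rfl
      (valuation [numberTerm k a, levelTerm k, numberTerm k b])
      (by simpa [body_pairRule, subst_app, valuation, -Prod.forall] using ⟨top a, top b⟩)
    obtain ⟨e0, e1, e2⟩ := extend_pairRule (valuation [numberTerm k a, levelTerm k, numberTerm k b])
    simp only [head_pairRule, subst_app, e0, e1, e2, List.forall_mem_cons, List.map_cons,
      List.map_nil] at this
    exact ⟨this.1, this.2.1⟩
  have fst a b := (pair a b).1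
  have snd a b := (pair a b).2
  have zero : zero.app [numberTerm k 0] ∈ M := by
    refine hzero.app [numberTerm k 0, levelTerm k] ?_
    simpa [subst_app, valuation, -Prod.forall] using ⟨top 0, pos 0⟩
  have succ : ∀ m, succ.app [numberTerm k m, numberTerm k (m + 1)] ∈ M := by
    intro m
    refine hsucc.app [numberTerm k m, levelTerm k, levelTerm (k - m), numberTerm k (m + 1),
      levelTerm (k - (m + 1))] ?_
    simpa [subst_app, valuation, -Prod.forall] using
      ⟨top m, pos m, top (m + 1), pos (m + 1), step m⟩
  have lt : ∀ a b, a < b → lt.app [numberTerm k a, numberTerm k b] ∈ M := by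
    intro a b hab
    induction b, hab using Nat.le_induction with
    | base =>
      refine hlt.app [numberTerm k a, numberTerm k (a + 1)] ?_
      simpa [subst_app, valuation, -Prod.forall] using succ a
    | succ b _ ih =>
      refine hlt'.app [numberTerm k a, numberTerm k b, numberTerm k (b + 1)] ?_
      simpa [subst_app, valuation, -Prod.forall] using ⟨ih, succ b⟩
  -- Induction on the code, not on the components, because the rules pass from the pair coded by `x`
  -- to the pair coded by `x + 1`.
  have code : ∀ x a b, Nat.pair a b = x → code.app [pairTerm k a b, numberTerm k x] ∈ M := by
    intro x
    induction x with
    | zero =>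
      intro a b h
      obtain ⟨rfl, rfl⟩ : a = 0 ∧ b = 0 := by
        have := Nat.left_le_pair a b
        have := Nat.right_le_pair a b
        omega
      refine hcode.app [numberTerm k 0, pairTerm k 0 0] ?_
      simpa [subst_app, valuation, -Prod.forall] using ⟨zero, fst 0 0, snd 0 0⟩
    | succ x ih =>
      intro a' b' h
      obtain ⟨a, b, hab⟩ : ∃ a b, Nat.pair a b = x := ⟨_, _, Nat.pair_unpair x⟩
      have heq : ∀ {p q}, Nat.pair p q = Nat.pair a b + 1 → p = a' ∧ q = b' := fun hpq =>
        Nat.pair_eq_pair.1 (by rw [hpq, hab, h])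
      rcases lt_trichotomy a b with hlt | rfl | hlt
      · rcases (Nat.succ_le_of_lt hlt).lt_or_eq with hlt | rfl
        · obtain ⟨rfl, rfl⟩ := heq (pair_succ_left hlt)
          refine hcode1.app [pairTerm k a b, numberTerm k x, numberTerm k (x + 1), numberTerm k a,
            numberTerm k b, numberTerm k (a + 1), pairTerm k (a + 1) b] ?_
          simpa [subst_app, valuation, -Prod.forall] using
            ⟨ih _ _ hab, succ x, fst _ _, snd _ _, succ a, lt _ _ hlt, fst _ _, snd _ _⟩
        · obtain ⟨rfl, rfl⟩ := heq (pair_zero_right a)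
          refine hcode2.app [pairTerm k a (a + 1), numberTerm k x, numberTerm k (x + 1),
            numberTerm k a, numberTerm k (a + 1), numberTerm k 0, pairTerm k (a + 1) 0] ?_
          simpa [subst_app, valuation, -Prod.forall] using
            ⟨ih _ _ hab, succ x, fst _ _, snd _ _, succ a, zero, fst _ _, snd _ _⟩
      · obtain ⟨rfl, rfl⟩ := heq (pair_zero_left a)
        refine hcode3.app [pairTerm k a a, numberTerm k x, numberTerm k (x + 1),
          numberTerm k a, numberTerm k (a + 1), numberTerm k 0, pairTerm k 0 (a + 1)] ?_
        simpa [subst_app, valuation, -Prod.forall] using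
          ⟨ih _ _ hab, succ x, fst _ _, snd _ _, succ a, zero, fst _ _, snd _ _⟩
      · obtain ⟨rfl, rfl⟩ := heq (pair_succ_right hlt)
        refine hcode4.app [pairTerm k a b, numberTerm k x, numberTerm k (x + 1), numberTerm k a,
          numberTerm k b, numberTerm k (b + 1), pairTerm k a (b + 1)] ?_
        simpa [subst_app, valuation, -Prod.forall] using
          ⟨ih _ _ hab, succ x, fst _ _, snd _ _, lt _ _ hlt, succ b, fst _ _, snd _ _⟩
  exact ⟨top, pos, succ, zero, fst, snd, fun a b => code _ a b rfl⟩

theorem checked_mem_chaseLimit (h : HasNumbers (chaseLimit (search c n) D) k)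
    (h0 : ∀ m, c.eval (Nat.pair n m) = 0) (m : ℕ) :
    checked.app [numberTerm k m] ∈ chaseLimit (search c n) D := by
  have hS : ∀ r ∈ searchRules c, Closed (chaseLimit (search c n) D) r := fun r hr =>
    closed_of_mem_datalogRules (by simp [datalogRules, hr])
  simp only [searchRules, List.forall_mem_cons] at hS
  have hinput : input.app [numberTerm k n] ∈ chaseLimit (search c n) D := by
    have := closed_of_mem_datalogRules (c := c) (n := n) (D := D) List.mem_cons_self (numberTerm k)
    simp only [inputRule, Rule.body, Rule.head, List.forall_mem_cons, List.not_mem_nil,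
      false_imp_iff, implies_true, and_true, List.forall_mem_map, subst_app, List.map_cons,
      List.map_nil] at this
    exact this ⟨h.zero, fun i _ => h.succ i⟩
  induction m with
  | zero =>
    refine hS.1.app [numberTerm k 0] ?_
    simpa [subst_app, valuation, -Prod.forall] using h.zero
  | succ m ih =>
    refine hS.2.1.app [numberTerm k m, numberTerm k (m + 1), numberTerm k n, pairTerm k n m,
      numberTerm k (Nat.pair n m), numberTerm k 0] ?_
    have hg := h.graph (c := c) (fun r hr =>
      closed_of_mem_datalogRules (by simp [datalogRules, hr])) (Nat.pair n m)
    rw [h0 m] at hg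
    simpa [subst_app, valuation, -Prod.forall] using
      ⟨ih, h.succ m, hinput, h.fst _ _, h.snd _ _, h.code _ _, hg, h.zero⟩

end

theorem not_depthLE_levelTerm (k : ℕ) : ¬ DepthLE k (levelTerm (k + 1)) := by
  induction k with
  | zero => rintro ⟨c, hc⟩; cases hc
  | succ k ih =>
    rintro (⟨c, hc⟩ | ⟨i, z, l, hl, h⟩)
    · cases hc
    · cases hl
      exact ih (h _ (List.mem_singleton_self _))

theorem not_chaseTerminates_search {c : PrimCode} {n : ℕ}
    (h0 : ∀ m, c.eval (Nat.pair n m) = 0) : ¬ ChaseTerminates (search c n) startInstance := by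
  set M := chaseLimit (search c n) startInstance with hM
  have hD : ∀ A ∈ startInstance, A.subst Term.const ∈ M := fun A hA =>
    Set.mem_iUnion.2 ⟨0, A, hA, rfl⟩
  have hbot : bot.app [levelTerm 0] ∈ M := hD (bot.app [0]) (by simp [startInstance])
  have hlevel : ∀ k, HasLevel M k := by
    intro k
    induction k with
    | zero =>
      exact ⟨hD (le.app [0, 0]) (by simp [startInstance]),
        hD (step.app [0, 0]) (by simp [startInstance]), by simp⟩
    | succ k ih =>
      have hk := ih.hasNumbers
      -- The number `k` on level `k` has level `0` as its position, which is marked by `bot`; so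
      -- `growRule` applies to it.
      have hpos := hk.pos k
      rw [Nat.sub_self] at hpos
      let σ := valuation [numberTerm k k, levelTerm k, levelTerm 0]
      have := chaseLimit_closed (P := search c n) (D := startInstance) (i := 0) (r := growRule) rfl
        σ (by simpa [σ, body_growRule, subst_app, valuation, -Prod.forall] using
          ⟨checked_mem_chaseLimit hk h0 k, hk.top k, hpos, hbot⟩)
      obtain ⟨e1, e3⟩ := extend_growRule σ
      simp only [head_growRule, subst_app, e1, e3, List.forall_mem_cons, List.map_cons,
        List.map_nil] at this
      refine ⟨this.2.1, ih.step_zero, fun i hi => ?_⟩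
      rcases Nat.lt_succ_iff_lt_or_eq.1 hi with hi | rfl
      · exact ih.step_lt i hi
      · exact this.1
  exact not_chaseTerminates fun k =>
    ⟨_, (hlevel (k + 1)).le_self, _, List.mem_cons_self, not_depthLE_levelTerm k⟩

theorem allInstanceTermination_search (c : PrimCode) (n : ℕ) :
    AllInstanceTermination (search c n) ↔ ∃ m, c.eval (Nat.pair n m) ≠ 0 := by
  constructor
  · intro h
    by_contra! h0
    exact not_chaseTerminates_search h0 (h startInstance (by simp [startInstance]))
  · rintro ⟨m, hm⟩ D hD
    exact chaseTerminates_search hm hD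

theorem manyOneReducible_allInstanceTermination {p : ℕ → Prop} (hp : REPred p) :
    p ≤₀ fun P : BinaryProgram => AllInstanceTermination P.1 := by
  obtain ⟨c, hc⟩ := hp.exists_primCode
  exact ⟨_, computable_search c, fun n =>
    (hc n).trans (allInstanceTermination_search c n).symm⟩

end TGD

theorem mainTheorem4 :
    (¬ ComputablePred fun P : TGD.BinaryProgram => TGD.AllInstanceTermination P.1) ∧
    ∀ p : ℕ → Prop, REPred p →
      p ≤₀ fun P : TGD.BinaryProgram => TGD.AllInstanceTermination P.1 := by
  refine ⟨fun h => ?_, fun p hp => TGD.manyOneReducible_allInstanceTermination hp⟩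
  -- The halting problem on input `0`, moved from codes to their numbers, is recursively enumerable
  -- and undecidable.
  let p : ℕ → Prop := fun m => (Nat.Partrec.Code.eval (Denumerable.ofNat _ m) 0).Dom
  have hp : REPred p :=
    (Nat.Partrec.Code.eval_part.comp (Computable.ofNat _) (Computable.const 0)).dom_re
  have hcomp := ComputablePred.computable_of_manyOneReducible
    (TGD.manyOneReducible_allInstanceTermination hp) h
  refine ComputablePred.halting_problem 0 (ComputablePred.computable_of_manyOneReducible
    ⟨Encodable.encode, Computable.encode, fun c => ?_⟩ hcomp)
  simp [p]
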